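/- Let $(\Omega,\mathcal G,\mathbb P)$ be a probability space, let $k,d\ge 0$ be integers, and let $(\mathcal F_N)_{N}$ be a sequence of sub-$\sigma$-algebras of $\mathcal G$. For each $N$, let $W_{1N},\dots,W_{NN}$ be $\mathbb R^k$-valued random variables on $\Omega$ that are i.i.d. conditionally on $\mathcal F_N$, that is, conditionally independent given $\mathcal F_N$ and with the same conditional distribution given $\mathcal F_N$. Put $W_N=\frac1{\sqrt N}\sum_{u=1}^N W_{uN}$. Suppose that almost surely $$\mathbb E[W_{uN}\mid\mathcal F_N]=0,\qquad \mathbb E[W_{uN}W_{uN}^\top\mid\mathcal F_N]=I_k ,$$ where the $W_{uN}$ are square integrable (which the second identity forces), and that, as $N\to\infty$, $$\frac{\mathbb E[\|W_{uN}\|_2^4\mid\mathcal F_N]}{N}=o_p(1),\qquad \frac{\mathbb E[\|W_{uN}\|_2^3\mid\mathcal F_N]}{\sqrt N}=o_p(1).$$ Here the conditional expectations of the nonnegative variables $\|W_{uN}\|_2^4$ and $\|W_{uN}\|_2^3$ take values in $[0,\infty]$ (the unconditional moments need not be finite), they do not depend on $u$ up to null sets, and $o_p(1)$ denotes convergence to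 $0$ in probability. Let $X_N$ be $\mathcal F_N$-measurable random variables in $\mathbb R^k$, and let $g_N:\mathbb R^k\to\mathbb R^d$ be measurable. Let $f:\mathbb R^{d+k}\to\mathbb R$ satisfy $\|f\|_{\mathrm{BL}}\le 1$, where $$\|f\|_{\mathrm{BL}}=\sup_{x\ne y}\frac{|f(x)-f(y)|}{\|x-y\|_2}+\sup_x|f(x)| .$$ Then $$\mathbb E[f(g_N(X_N),W_N)\mid\mathcal F_N]-\mathbb E[f(g_N(X_N),Z)\mid\mathcal F_N]=o_p(1),$$ where $Z\sim N(0,I_k)$ is independent of $\mathcal F_N$. The claim holds both when the second term is read as $\int_{\mathbb R^k} f(g_N(X_N),z)\,N(0,I_k)(dz)$, for which no such $Z$ has to exist on $\Omega$, and when it is the conditional expectation for any $Z\sim N(0,I_k)$ that is defined on $\Omega$ and independent of $\mathcal F_N$ for every $N$. -/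

import Mathlib

open MeasureTheory ProbabilityTheory Filter Topology
open scoped ENNReal

/-- The Lipschitz seminorm `sup_{x ≠ y} |f x - f y| / ‖x - y‖₂` of `f : ℝⁿ → ℝ`, in `[0, ∞]`. -/
noncomputable def lipSeminorm {n : ℕ} (f : EuclideanSpace ℝ (Fin n) → ℝ) : ℝ≥0∞ :=
  ⨆ (x : EuclideanSpace ℝ (Fin n)) (y : EuclideanSpace ℝ (Fin n)) (_ : x ≠ y),
    edist (f x) (f y) / edist x y

/-- The supremum norm `sup_x |f x|` of `f : ℝⁿ → ℝ`, in `[0, ∞]`. -/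
noncomputable def supNorm {n : ℕ} (f : EuclideanSpace ℝ (Fin n) → ℝ) : ℝ≥0∞ :=
  ⨆ x : EuclideanSpace ℝ (Fin n), ‖f x‖ₑ

/-- The bounded Lipschitz norm `‖f‖_BL = ‖f‖_L + ‖f‖_∞` of `f : ℝⁿ → ℝ`, in `[0, ∞]`. -/
noncomputable def blNorm {n : ℕ} (f : EuclideanSpace ℝ (Fin n) → ℝ) : ℝ≥0∞ :=
  lipSeminorm f + supNorm f

/-- The vector `(a, w) ∈ ℝ^{d+k}` with blocks `a ∈ ℝ^d` and `w ∈ ℝ^k`. -/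
def concatVec {d k : ℕ} (a : EuclideanSpace ℝ (Fin d)) (w : EuclideanSpace ℝ (Fin k)) :
    EuclideanSpace ℝ (Fin (d + k)) :=
  WithLp.toLp 2 (Fin.append a.ofLp w.ofLp)

/-- The family `W` is conditionally i.i.d. given the sub-σ-algebra `m`: it is conditionally
independent given `m`, and all its members have the same conditional distribution given `m`.
The notation `μ⟦s | m⟧` is the conditional probability of `s` given `m`. -/
structure CondIID {Ω ι E : Type*} [MeasurableSpace E] {m0 : MeasurableSpace Ω} (μ : Measure Ω)
    (m : MeasurableSpace Ω) (W : ι → Ω → E) : Prop where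
  indep : ∀ (S : Finset ι) (B : ι → Set E), (∀ u ∈ S, MeasurableSet (B u)) →
    μ⟦⋂ u ∈ S, W u ⁻¹' B u | m⟧ =ᵐ[μ] ∏ u ∈ S, μ⟦W u ⁻¹' B u | m⟧
  ident : ∀ (u v : ι) (B : Set E), MeasurableSet B → μ⟦W u ⁻¹' B | m⟧ =ᵐ[μ] μ⟦W v ⁻¹' B | m⟧

/-- The normalized sum `N^{-1/2} ∑_{u ≤ N} W_u`. -/
noncomputable def normalizedSum {Ω : Type*} {k N : ℕ}
    (W : Fin N → Ω → EuclideanSpace ℝ (Fin k)) (ω : Ω) : EuclideanSpace ℝ (Fin k) :=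
  (Real.sqrt N)⁻¹ • ∑ u, W u ω

/-- The conditional absolute moment `E[‖Y‖₂ ^ p | m]`, with values in `[0, ∞]`, so that no
unconditional moment has to be finite. -/
noncomputable def condMoment {Ω : Type*} {k : ℕ} {m0 : MeasurableSpace Ω} (μ : Measure Ω)
    (m : MeasurableSpace Ω) (p : ℕ) (Y : Ω → EuclideanSpace ℝ (Fin k)) : Ω → ℝ≥0∞ :=
  μ⁻[fun ω => ‖Y ω‖ₑ ^ p | m]

/-- `Y N = o_p(1)` for `[0, ∞]`-valued `Y N`: for every `ε > 0`, `μ(Y N ≥ ε) → 0`. -/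
def IsLittleOpOne {Ω : Type*} {m0 : MeasurableSpace Ω} (μ : Measure Ω) (Y : ℕ → Ω → ℝ≥0∞) : Prop :=
  ∀ ε : ℝ≥0∞, 0 < ε → Tendsto (fun N => μ {ω | ε ≤ Y N ω}) atTop (𝓝 0)

/-! Conditionally on `F N`, the vectors `W N u` are genuinely i.i.d., so the claim reduces to a
quantitative CLT for a deterministic law `ν`, with an error bound uniform in `ν`, applied to the
regular conditional law at almost every `ω`.

The deterministic bound (`exists_abs_integral_normalized_sum_sub_stdGaussian_le`) is Lindeberg's
replacement argument. The bounded Lipschitz test function is mollified at scale `t`, which costs `t`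
on each side. The Gaussian is itself a normalized sum of `n` Gaussians, and the summands are swapped
one at a time. The first two moments match, so each swap costs only a third-order Taylor remainder
of size `n^{-3/2}` times third moments. The total is `2 t + C (E‖Y‖³ + C) / √n`, with `C` depending
only on `t` and the space.

`ae_exists_conditional_law` supplies the random law: almost surely the conditional distribution of
the whole array is a product of one centred marginal with identity covariance. The value `g_N (X_N)`
is frozen by conditioning and only translates the test function. Since `C` is uniform, smallness in
probability of the conditional third moment over `√N` carries over to the difference of conditional
expectations. -/

/-! ### Taylor remainders under a Lipschitz second derivative. -/

section Taylor
variable {E : Type*} [NormedAddCommGroup E] [NormedSpace ℝ E]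

theorem norm_sub_sub_fderiv_le {F : Type*} [NormedAddCommGroup F] [NormedSpace ℝ F] {f : E → F}
    (hf : Differentiable ℝ f) {K : ℝ} (hK0 : 0 ≤ K)
    (hK : ∀ x y, ‖fderiv ℝ f x - fderiv ℝ f y‖ ≤ K * ‖x - y‖) (x y : E) :
    ‖f (x + y) - f x - fderiv ℝ f x y‖ ≤ K * ‖y‖ ^ 2 := by
  have hd : ∀ z, HasFDerivAt (fun z => f (x + z) - fderiv ℝ f x z)
      (fderiv ℝ f (x + z) - fderiv ℝ f x) z := fun z =>
    ((hf (x + z)).hasFDerivAt.comp z ((hasFDerivAt_id z).const_add x)).sub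
      (fderiv ℝ f x).hasFDerivAt
  have hb : ∀ z ∈ Metric.closedBall (0 : E) ‖y‖,
      ‖fderiv ℝ f (x + z) - fderiv ℝ f x‖ ≤ K * ‖y‖ := by
    intro z hz
    refine (hK (x + z) x).trans (mul_le_mul_of_nonneg_left ?_ hK0)
    simpa using hz
  have := (convex_closedBall (0 : E) ‖y‖).norm_image_sub_le_of_norm_hasFDerivWithin_le
    (fun z _ => (hd z).hasFDerivWithinAt) hb (x := 0) (y := y) (by simp) (by simp)
  calc _ = ‖f (x + y) - fderiv ℝ f x y - (f (x + 0) - fderiv ℝ f x 0)‖ := by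
        congr 1; simp; abel
    _ ≤ K * ‖y‖ * ‖y - 0‖ := this
    _ = _ := by rw [sub_zero]; ring

/-- The derivative of the second-order remainder is the first-order remainder of `fderiv ℝ f`, so
the mean value inequality on the ball of radius `‖y‖` gains one power. The constant is not optimal.
-/
theorem abs_sub_taylor_two_le {f : E → ℝ} (hf : ContDiff ℝ 2 f) {K : ℝ} (hK0 : 0 ≤ K)
    (hK : ∀ x y, ‖fderiv ℝ (fderiv ℝ f) x - fderiv ℝ (fderiv ℝ f) y‖ ≤ K * ‖x - y‖) (x y : E) :
    |f (x + y) - f x - fderiv ℝ f x y - 2⁻¹ * fderiv ℝ (fderiv ℝ f) x y y| ≤ K * ‖y‖ ^ 3 := by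
  set B := fderiv ℝ (fderiv ℝ f) x with hB
  have hdf : Differentiable ℝ f := hf.differentiable (by norm_num)
  have hddf : Differentiable ℝ (fderiv ℝ f) :=
    (hf.fderiv_right (m := 1) (by norm_num)).differentiable (by norm_num)
  have hsymm : ∀ u v, B u v = B v u := fun u v =>
    (hf.contDiffAt (x := x)).isSymmSndFDerivAt (by simp) u v
  have hd : ∀ z, HasFDerivAt (fun z => f (x + z) - fderiv ℝ f x z - 2⁻¹ * B z z)
      (fderiv ℝ f (x + z) - fderiv ℝ f x - B z) z := by
    intro z
    -- Symmetry of the second derivative turns `2⁻¹ (B z v + B v z)` into `B z v`.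
    have h2 : HasFDerivAt (fun z => 2⁻¹ * B z z) (B z) z := by
      have := ((B.hasFDerivAt (x := z)).clm_apply (hasFDerivAt_id z)).const_mul (2⁻¹ : ℝ)
      refine this.congr_fderiv ?_
      ext v
      simp [hsymm v z]
      ring
    exact (((hdf (x + z)).hasFDerivAt.comp z ((hasFDerivAt_id z).const_add x)).sub (fderiv ℝ f x).hasFDerivAt).sub h2
  have hb : ∀ z ∈ Metric.closedBall (0 : E) ‖y‖,
      ‖fderiv ℝ f (x + z) - fderiv ℝ f x - B z‖ ≤ K * ‖y‖ ^ 2 := by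
    intro z hz
    refine (norm_sub_sub_fderiv_le hddf hK0 hK x z).trans ?_
    have : ‖z‖ ≤ ‖y‖ := by simpa using hz
    gcongr
  have := (convex_closedBall (0 : E) ‖y‖).norm_image_sub_le_of_norm_hasFDerivWithin_le
    (fun z _ => (hd z).hasFDerivWithinAt) hb (x := 0) (y := y) (by simp) (by simp)
  calc _ = ‖f (x + y) - fderiv ℝ f x y - 2⁻¹ * B y y
          - (f (x + 0) - fderiv ℝ f x 0 - 2⁻¹ * B 0 0)‖ := by
        rw [Real.norm_eq_abs]; congr 1; simp; ring
    _ ≤ K * ‖y‖ ^ 2 * ‖y - 0‖ := this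
    _ = _ := by rw [sub_zero]; ring

end Taylor

/-! ### Smoothing by convolution, with derivative bounds uniform in the test function. -/

section Mollify

open ContinuousLinearMap
open scoped Convolution

variable {E : Type*} [NormedAddCommGroup E] [NormedSpace ℝ E] [FiniteDimensional ℝ E]
  [MeasurableSpace E] [BorelSpace E] {μ : Measure E} [μ.IsAddHaarMeasure]

theorem hasFDerivAt_convolution_lsmul {F : Type*} [NormedAddCommGroup F] [NormedSpace ℝ F]
    {h : E → ℝ} (hh : LocallyIntegrable h μ) {g : E → F} (hg : ContDiff ℝ 1 g)
    (hgc : HasCompactSupport g) :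
    ∀ x, HasFDerivAt (h ⋆[lsmul ℝ ℝ, μ] g) ((h ⋆[lsmul ℝ ℝ, μ] fderiv ℝ g) x) x :=
  fun x => hgc.hasFDerivAt_convolution_right (lsmul ℝ ℝ) hh hg x

theorem norm_convolution_lsmul_le {F : Type*} [NormedAddCommGroup F] [NormedSpace ℝ F]
    {h : E → ℝ} (hh : ∀ x, |h x| ≤ 1) {g : E → F} (hg : Integrable g μ) (x : E) :
    ‖(h ⋆[lsmul ℝ ℝ, μ] g) x‖ ≤ ∫ u, ‖g u‖ ∂μ := by
  rw [convolution_def]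
  refine (norm_integral_le_of_norm_le (g := fun t => ‖g (x - t)‖)
    ((integrable_comp_sub_left g x).2 hg).norm (ae_of_all _ fun t => ?_)).trans_eq ?_
  · rw [lsmul_apply, norm_smul]
    exact mul_le_of_le_one_left (norm_nonneg _) (hh t)
  · exact integral_sub_left_eq_self (fun u => ‖g u‖) μ x

set_option maxSynthPendingDepth 3 in
-- All derivatives fall on `φ`, so the third derivative of the convolution is bounded by the `L¹`
-- norm of that of `φ`. `K` must not depend on `h`, because the replacement induction changes `h` at
-- each step.
theorem exists_lipschitz_fderiv_fderiv_convolution {φ : E → ℝ} (hφ : ContDiff ℝ 3 φ)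
    (hφc : HasCompactSupport φ) :
    ∃ K : ℝ, 0 ≤ K ∧ ∀ h : E → ℝ, Continuous h → (∀ x, |h x| ≤ 1) →
      ContDiff ℝ 2 (φ ⋆[lsmul ℝ ℝ, μ] h) ∧
      ∀ x y, ‖fderiv ℝ (fderiv ℝ (φ ⋆[lsmul ℝ ℝ, μ] h)) x
        - fderiv ℝ (fderiv ℝ (φ ⋆[lsmul ℝ ℝ, μ] h)) y‖ ≤ K * ‖x - y‖ := by
  refine ⟨∫ u, ‖fderiv ℝ (fderiv ℝ (fderiv ℝ φ)) u‖ ∂μ, integral_nonneg fun _ => norm_nonneg _,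
    fun h hc hb => ?_⟩
  have hflip : (φ ⋆[lsmul ℝ ℝ, μ] h) = (h ⋆[lsmul ℝ ℝ, μ] φ) := by
    rw [← convolution_flip]
    congr 1
    ext
    simp
  have hh : LocallyIntegrable h μ := hc.locallyIntegrable
  have c1 : ContDiff ℝ 2 (fderiv ℝ φ) := hφ.fderiv_right (by norm_num)
  have c2 : ContDiff ℝ 1 (fderiv ℝ (fderiv ℝ φ)) := c1.fderiv_right (by norm_num)
  have c3 : Continuous (fderiv ℝ (fderiv ℝ (fderiv ℝ φ))) := c2.continuous_fderiv (by norm_num)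
  have s1 := hφc.fderiv ℝ
  have s2 := s1.fderiv ℝ
  have s3 := s2.fderiv ℝ
  have d1 := hasFDerivAt_convolution_lsmul hh (hφ.of_le (by norm_num)) hφc
  have d2 := hasFDerivAt_convolution_lsmul hh (c1.of_le (by norm_num)) s1
  have d3 := hasFDerivAt_convolution_lsmul hh c2 s2
  have e1 : fderiv ℝ (h ⋆[lsmul ℝ ℝ, μ] φ) = h ⋆[lsmul ℝ ℝ, μ] fderiv ℝ φ :=
    funext fun x => (d1 x).fderiv
  have e2 : fderiv ℝ (h ⋆[lsmul ℝ ℝ, μ] fderiv ℝ φ) = h ⋆[lsmul ℝ ℝ, μ] fderiv ℝ (fderiv ℝ φ) :=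
    funext fun x => (d2 x).fderiv
  rw [hflip]
  refine ⟨hφc.contDiff_convolution_right _ hh (hφ.of_le (by norm_num)), fun x y => ?_⟩
  rw [e1, e2]
  exact convex_univ.norm_image_sub_le_of_norm_hasFDerivWithin_le
    (fun z _ => (d3 z).hasFDerivWithinAt)
    (fun z _ => norm_convolution_lsmul_le hb (c3.integrable_of_hasCompactSupport s3) z)
    (Set.mem_univ y) (Set.mem_univ x)

end Mollify

theorem abs_integral_le_of_abs_le {α : Type*} {mα : MeasurableSpace α} (ρ : Measure α)
    [IsProbabilityMeasure ρ] {f : α → ℝ} {M : ℝ} (hf : ∀ x, |f x| ≤ M) : |∫ x, f x ∂ρ| ≤ M := by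
  have : ∀ᵐ x ∂ρ, ‖f x‖ ≤ M := ae_of_all _ hf
  simpa using norm_integral_le_of_norm_le_const this

/-! ### Lindeberg replacement for convolution powers. -/

section Lindeberg

open ContinuousLinearMap
open scoped Convolution

variable {E : Type*} [NormedAddCommGroup E] [NormedSpace ℝ E] [FiniteDimensional ℝ E]
  [MeasurableSpace E] [BorelSpace E]

theorem abs_integral_sub_taylor_two_le {H : E → ℝ} (hH : ContDiff ℝ 2 H) {K : ℝ} (hK0 : 0 ≤ K)
    (hK : ∀ x y, ‖fderiv ℝ (fderiv ℝ H) x - fderiv ℝ (fderiv ℝ H) y‖ ≤ K * ‖x - y‖)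
    (ν : Measure E) [IsProbabilityMeasure ν] (h3 : Integrable (fun y => ‖y‖ ^ 3) ν)
    {c : ℝ} (hc : 0 ≤ c) (x : E) :
    |∫ y, H (x + c • y) ∂ν - (H x + c * ∫ y, fderiv ℝ H x y ∂ν
      + 2⁻¹ * c ^ 2 * ∫ y, fderiv ℝ (fderiv ℝ H) x y y ∂ν)| ≤ K * c ^ 3 * ∫ y, ‖y‖ ^ 3 ∂ν := by
  set D := fderiv ℝ H x
  set B := fderiv ℝ (fderiv ℝ H) x
  have hm3 : MemLp id 3 ν := by
    rw [← integrable_norm_rpow_iff aestronglyMeasurable_id (by norm_num) (by norm_num)]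
    simpa using h3
  have i1 : Integrable (fun y => ‖y‖) ν := (hm3.integrable (by norm_num)).norm
  have i2 : Integrable (fun y => ‖y‖ ^ 2) ν :=
    (hm3.mono_exponent (by norm_num : (2 : ℝ≥0∞) ≤ 3)).integrable_norm_pow (by norm_num)
  have iD : Integrable (fun y => D y) ν :=
    (i1.const_mul ‖D‖).mono' (by fun_prop) (ae_of_all _ fun y => D.le_opNorm y)
  have iB : Integrable (fun y => B y y) ν :=
    (i2.const_mul ‖B‖).mono' (by fun_prop) (ae_of_all _ fun y => by
      rw [sq, ← mul_assoc]; exact B.le_opNorm₂ y y)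
  have hR : ∀ y, ‖H (x + c • y) - (H x + c * D y + 2⁻¹ * c ^ 2 * B y y)‖
      ≤ K * c ^ 3 * ‖y‖ ^ 3 := by
    intro y
    have := abs_sub_taylor_two_le hH hK0 hK x (c • y)
    rw [norm_smul, Real.norm_of_nonneg hc, mul_pow, ← mul_assoc] at this
    refine le_trans (le_of_eq ?_) this
    rw [Real.norm_eq_abs]
    congr 1
    simp only [map_smul, smul_apply, smul_eq_mul]
    ring
  have iP : Integrable (fun y => H x + c * D y + 2⁻¹ * c ^ 2 * B y y) ν :=
    ((integrable_const _).add (iD.const_mul c)).add (iB.const_mul _)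
  have hHc : Continuous H := hH.continuous
  have iR : Integrable (fun y => H (x + c • y) - (H x + c * D y + 2⁻¹ * c ^ 2 * B y y)) ν :=
    (h3.const_mul (K * c ^ 3)).mono' (by fun_prop) (ae_of_all _ hR)
  have iH : Integrable (fun y => H (x + c • y)) ν := by
    refine (iR.add iP).congr (ae_of_all _ fun y => ?_)
    simp
  have hP : ∫ y, (H x + c * D y + 2⁻¹ * c ^ 2 * B y y) ∂ν
      = H x + c * ∫ y, D y ∂ν + 2⁻¹ * c ^ 2 * ∫ y, B y y ∂ν := by
    rw [integral_add (by exact (integrable_const _).add (iD.const_mul c)) (iB.const_mul _),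
      integral_add (integrable_const _) (iD.const_mul c), integral_const_mul, integral_const_mul]
    simp
  rw [← hP, ← integral_sub iH iP, ← integral_const_mul]
  exact norm_integral_le_of_norm_le (h3.const_mul _) (ae_of_all _ hR)

/-- Cost of a single swap: the Taylor terms up to order two cancel, leaving the two remainders. -/
theorem abs_integral_sub_integral_le_of_moments_eq {H : E → ℝ} (hH : ContDiff ℝ 2 H) {K : ℝ}
    (hK0 : 0 ≤ K)
    (hK : ∀ x y, ‖fderiv ℝ (fderiv ℝ H) x - fderiv ℝ (fderiv ℝ H) y‖ ≤ K * ‖x - y‖)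
    (ν ν' : Measure E) [IsProbabilityMeasure ν] [IsProbabilityMeasure ν']
    (h3 : Integrable (fun y => ‖y‖ ^ 3) ν) (h3' : Integrable (fun y => ‖y‖ ^ 3) ν')
    (hL : ∀ L : E →L[ℝ] ℝ, ∫ y, L y ∂ν = ∫ y, L y ∂ν')
    (hB : ∀ B : E →L[ℝ] E →L[ℝ] ℝ, ∫ y, B y y ∂ν = ∫ y, B y y ∂ν')
    {c : ℝ} (hc : 0 ≤ c) (x : E) :
    |∫ y, H (x + c • y) ∂ν - ∫ y, H (x + c • y) ∂ν'|
      ≤ K * c ^ 3 * (∫ y, ‖y‖ ^ 3 ∂ν + ∫ y, ‖y‖ ^ 3 ∂ν') := by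
  have h1 := abs_integral_sub_taylor_two_le hH hK0 hK ν h3 hc x
  have h2 := abs_integral_sub_taylor_two_le hH hK0 hK ν' h3' hc x
  rw [hL, hB] at h1
  rw [abs_le] at *
  constructor <;> linarith [h1.1, h1.2, h2.1, h2.2]

/-- The `n`-fold convolution power of a measure. -/
noncomputable def convPow (ν : Measure E) : ℕ → Measure E
  | 0 => Measure.dirac 0
  | n + 1 => (convPow ν n) ∗ ν

instance isProbabilityMeasure_convPow (ν : Measure E) [IsProbabilityMeasure ν] (n : ℕ) :
    IsProbabilityMeasure (convPow ν n) := by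
  induction n with
  | zero => rw [convPow]; infer_instance
  | succ n ih => rw [convPow]; infer_instance

theorem integral_convPow_succ (ν : Measure E) [IsProbabilityMeasure ν] (n : ℕ) {G : E → ℝ}
    (hG : Continuous G) {M : ℝ} (hM : ∀ x, |G x| ≤ M) :
    ∫ s, G s ∂(convPow ν (n + 1)) = ∫ s, ∫ y, G (s + y) ∂ν ∂(convPow ν n) := by
  rw [convPow, Measure.conv, integral_map (by fun_prop) (by fun_prop), integral_prod]
  exact Integrable.of_bound (by fun_prop) M (ae_of_all _ fun p => hM _)

theorem map_sum_eq_convPow {Ω ι : Type*} {mΩ : MeasurableSpace Ω} {P : Measure Ω}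
    [IsProbabilityMeasure P] {Y : ι → Ω → E} (hY : ∀ i, Measurable (Y i)) (hind : iIndepFun Y P)
    {ν : Measure E} (hν : ∀ i, P.map (Y i) = ν) (s : Finset ι) :
    P.map (∑ i ∈ s, Y i) = convPow ν s.card := by
  classical
  induction s using Finset.induction_on with
  | empty =>
    rw [Finset.sum_empty, Finset.card_empty, convPow]
    exact (Measure.map_const P (0 : E)).trans (by simp)
  | insert a s ha ih =>
    have hm : Measurable (∑ i ∈ s, Y i) := by fun_prop
    rw [Finset.sum_insert ha, Finset.card_insert_of_notMem ha, convPow, ← ih, ← hν a, add_comm,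
      (hind.indepFun_finsetSum_of_notMem hY ha).map_add_eq_map_conv_map hm (hY a)]

/-- Fubini: averaging over a random shift commutes with mollification. The averaged smooth function
is thus again the mollification of a continuous function bounded by one, with the same `K`. -/
theorem convolution_integral_comp_add {μ : Measure E} [SFinite μ] {φ : E → ℝ}
    (hφ : Integrable φ μ) (hφc : Continuous φ) {h : E → ℝ} (hh : Continuous h)
    (hb : ∀ x, |h x| ≤ 1) (ν : Measure E) [IsProbabilityMeasure ν] (c : ℝ) (x : E) :
    ∫ y, (φ ⋆[lsmul ℝ ℝ, μ] h) (x + c • y) ∂ν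
      = (φ ⋆[lsmul ℝ ℝ, μ] fun z => ∫ y, h (z + c • y) ∂ν) x := by
  simp only [convolution_def, lsmul_apply, smul_eq_mul]
  rw [integral_integral_swap]
  · refine integral_congr_ae (ae_of_all _ fun u => ?_)
    simp only
    rw [integral_const_mul]
    congr 2 with y
    congr 1
    abel
  · have : Integrable (fun p : E × E => φ p.2) (ν.prod μ) := hφ.comp_snd ν
    refine this.norm.mono' (by simp only [Function.uncurry_def]; fun_prop) (ae_of_all _ fun p => ?_)
    simp only [Function.uncurry_def, norm_mul]
    exact mul_le_of_le_one_right (norm_nonneg _) (hb _)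

theorem abs_integral_convPow_sub_le {μ : Measure E} [μ.IsAddHaarMeasure] {φ : E → ℝ}
    (hφ : ContDiff ℝ 3 φ) (hφi : Integrable φ μ) {K : ℝ} (hK0 : 0 ≤ K)
    (hK : ∀ h : E → ℝ, Continuous h → (∀ x, |h x| ≤ 1) →
      ContDiff ℝ 2 (φ ⋆[lsmul ℝ ℝ, μ] h) ∧
      ∀ x y, ‖fderiv ℝ (fderiv ℝ (φ ⋆[lsmul ℝ ℝ, μ] h)) x
        - fderiv ℝ (fderiv ℝ (φ ⋆[lsmul ℝ ℝ, μ] h)) y‖ ≤ K * ‖x - y‖)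
    (ν ν' : Measure E) [IsProbabilityMeasure ν] [IsProbabilityMeasure ν']
    (h3 : Integrable (fun y => ‖y‖ ^ 3) ν) (h3' : Integrable (fun y => ‖y‖ ^ 3) ν')
    (hL : ∀ L : E →L[ℝ] ℝ, ∫ y, L y ∂ν = ∫ y, L y ∂ν')
    (hB : ∀ B : E →L[ℝ] E →L[ℝ] ℝ, ∫ y, B y y ∂ν = ∫ y, B y y ∂ν')
    {c : ℝ} (hc : 0 ≤ c) (n : ℕ) (h : E → ℝ) (hh : Continuous h) (hb : ∀ x, |h x| ≤ 1) (x : E) :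
    |∫ s, (φ ⋆[lsmul ℝ ℝ, μ] h) (x + c • s) ∂(convPow ν n)
      - ∫ s, (φ ⋆[lsmul ℝ ℝ, μ] h) (x + c • s) ∂(convPow ν' n)|
      ≤ n * (K * c ^ 3 * (∫ y, ‖y‖ ^ 3 ∂ν + ∫ y, ‖y‖ ^ 3 ∂ν')) := by
  induction n generalizing h x with
  | zero => simp [convPow]
  | succ n ih =>
    obtain ⟨hC, hD⟩ := hK h hh hb
    set H : E → ℝ := φ ⋆[lsmul ℝ ℝ, μ] h with hH
    have hHc : Continuous H := hC.continuous
    have hHb : ∀ z, |H z| ≤ ∫ u, ‖φ u‖ ∂μ := by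
      intro z
      rw [hH, convolution_def, ← Real.norm_eq_abs]
      refine norm_integral_le_of_norm_le hφi.norm (ae_of_all _ fun u => ?_)
      rw [lsmul_apply, smul_eq_mul, norm_mul]
      exact mul_le_of_le_one_right (norm_nonneg _) (hb _)
    have hint : ∀ (ρ : Measure E) [IsProbabilityMeasure ρ] (z : E),
        Integrable (fun y => H (z + c • y)) ρ := fun ρ _ z =>
      Integrable.of_bound (by fun_prop) _ (ae_of_all _ fun p => hHb _)
    have hcont : ∀ (ρ : Measure E) [IsProbabilityMeasure ρ] (G : E → ℝ), Continuous G →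
        ∀ M, (∀ z, |G z| ≤ M) → Continuous fun z => ∫ y, G (z + c • y) ∂ρ := fun ρ _ G hG M hM =>
      continuous_of_dominated (bound := fun _ => M) (fun z => by fun_prop)
        (fun z => ae_of_all _ fun y => hM _) (integrable_const _) (ae_of_all _ fun y => by fun_prop)
    have habs : ∀ (ρ : Measure E) [IsProbabilityMeasure ρ] (G : E → ℝ) (M : ℝ), (∀ z, |G z| ≤ M) →
        ∀ z, |∫ y, G (z + c • y) ∂ρ| ≤ M := fun ρ _ G M hM z =>
      abs_integral_le_of_abs_le ρ fun y => hM (z + c • y)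
    have hint2 : ∀ (ρ ρ' : Measure E) [IsProbabilityMeasure ρ] [IsProbabilityMeasure ρ'],
        Integrable (fun s => ∫ y, H (x + c • s + c • y) ∂ρ) ρ' := fun ρ ρ' _ _ =>
      Integrable.of_bound (((hcont ρ H hHc _ hHb).comp
        (by fun_prop : Continuous fun s : E => x + c • s)).aestronglyMeasurable) _
        (ae_of_all _ fun s => habs ρ H _ hHb _)
    have hsucc : ∀ (ρ : Measure E) [IsProbabilityMeasure ρ],
        ∫ s, H (x + c • s) ∂(convPow ρ (n + 1))
          = ∫ s, ∫ y, H (x + c • s + c • y) ∂ρ ∂(convPow ρ n) := fun ρ _ => by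
      rw [integral_convPow_succ ρ n (G := fun s => H (x + c • s)) (by fun_prop) fun s => hHb _]
      simp only [smul_add, add_assoc]
    rw [hsucc ν, hsucc ν']
    -- Swap the last summand, with the sum of the other `n` held fixed.
    have step1 : |∫ s, ∫ y, H (x + c • s + c • y) ∂ν ∂(convPow ν n)
        - ∫ s, ∫ y, H (x + c • s + c • y) ∂ν' ∂(convPow ν n)|
        ≤ K * c ^ 3 * (∫ y, ‖y‖ ^ 3 ∂ν + ∫ y, ‖y‖ ^ 3 ∂ν') := by
      rw [← integral_sub (hint2 ν _) (hint2 ν' _)]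
      exact abs_integral_le_of_abs_le _ fun s =>
        abs_integral_sub_integral_le_of_moments_eq hC hK0 hD ν ν' h3 h3' hL hB hc (x + c • s)
    -- The last summand now has law `ν'` on both sides; it is absorbed into the test function, and
    -- the induction hypothesis swaps the other `n`.
    have step2 := ih (fun z => ∫ y, h (z + c • y) ∂ν') (hcont ν' h hh 1 hb) (habs ν' h 1 hb) x
    simp only [← convolution_integral_comp_add hφi hφ.continuous hh hb ν' c] at step2
    push_cast
    rw [add_one_mul]
    rw [abs_le] at *
    constructor <;> linarith [step1.1, step1.2, step2.1, step2.2]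

end Lindeberg

/-! ### Quantitative CLT for bounded Lipschitz test functions. -/

section GaussianApproximation

variable {E : Type*} [NormedAddCommGroup E] [InnerProductSpace ℝ E] [FiniteDimensional ℝ E]
  [MeasurableSpace E] [BorelSpace E]

theorem charFun_convPow (ν : Measure E) [IsProbabilityMeasure ν] (n : ℕ) (t : E) :
    charFun (convPow ν n) t = charFun ν t ^ n := by
  induction n with
  | zero => simp [convPow]
  | succ n ih => rw [convPow, charFun_conv, ih, pow_succ]

theorem map_smul_convPow_stdGaussian {n : ℕ} (hn : n ≠ 0) :
    (convPow (stdGaussian E) n).map (fun s => (Real.sqrt n)⁻¹ • s) = stdGaussian E := by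
  have : IsProbabilityMeasure ((convPow (stdGaussian E) n).map
      (fun s => (Real.sqrt n)⁻¹ • s)) := Measure.isProbabilityMeasure_map (by fun_prop)
  refine Measure.ext_of_charFun (funext fun t => ?_)
  rw [charFun_map_smul, charFun_convPow, charFun_stdGaussian, charFun_stdGaussian,
    ← Complex.exp_nat_mul, norm_smul]
  congr 1
  have h2 : (Real.sqrt n) ^ 2 = n := Real.sq_sqrt (Nat.cast_nonneg n)
  have hn' : (n : ℝ) ≠ 0 := Nat.cast_ne_zero.2 hn
  have : (n : ℝ) * (-(‖(Real.sqrt n)⁻¹‖ * ‖t‖) ^ 2 / 2) = -‖t‖ ^ 2 / 2 := by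
    rw [mul_pow, norm_inv, inv_pow, Real.norm_eq_abs, sq_abs, h2]
    field_simp
  exact_mod_cast this

open ContinuousLinearMap in
open scoped Convolution in
theorem exists_abs_integral_normalized_sum_sub_stdGaussian_le {t : ℝ} (ht : 0 < t) :
    ∃ C : ℝ, 0 ≤ C ∧ ∀ (n : ℕ), n ≠ 0 → ∀ (ν : Measure E) [IsProbabilityMeasure ν],
      Integrable (fun y => ‖y‖ ^ 3) ν → (∀ L : E →L[ℝ] ℝ, ∫ y, L y ∂ν = 0) →
      (∀ B : E →L[ℝ] E →L[ℝ] ℝ, ∫ y, B y y ∂ν = ∫ y, B y y ∂(stdGaussian E)) →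
      ∀ h : E → ℝ, LipschitzWith 1 h → (∀ x, |h x| ≤ 1) →
      |∫ y, h ((Real.sqrt n)⁻¹ • ∑ i, y i) ∂(Measure.pi fun _ : Fin n => ν)
        - ∫ z, h z ∂(stdGaussian E)| ≤ 2 * t + C * ((∫ y, ‖y‖ ^ 3 ∂ν + C) / Real.sqrt n) := by
  -- A bump supported within radius `t` moves a 1-Lipschitz function by at most `t`.
  let φb : ContDiffBump (0 : E) := ⟨t / 2, t, by positivity, by linarith⟩
  let lam : Measure E := volume
  set φ : E → ℝ := φb.normed lam
  have hφ : ContDiff ℝ 3 φ := φb.contDiff_normed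
  have hφi : Integrable φ lam := φb.integrable_normed
  obtain ⟨K, hK0, hK⟩ := exists_lipschitz_fderiv_fderiv_convolution (μ := lam) hφ
    φb.hasCompactSupport_normed
  set γ := stdGaussian E with hγ
  have h3' : Integrable (fun y => ‖y‖ ^ 3) γ :=
    (IsGaussian.memLp_id γ 3 (by norm_num)).integrable_norm_pow (by norm_num)
  set m' := ∫ y, ‖y‖ ^ 3 ∂γ
  have hm' : 0 ≤ m' := integral_nonneg fun _ => by positivity
  -- A single constant dominates both the smoothness bound `K` and the Gaussian third moment `m'`.
  refine ⟨K + m', by positivity, fun n hn ν _ h3 hL hB h hh hb => ?_⟩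
  have hm : 0 ≤ ∫ y, ‖y‖ ^ 3 ∂ν := integral_nonneg fun _ => by positivity
  set m := ∫ y, ‖y‖ ^ 3 ∂ν
  have hhc : Continuous h := hh.continuous
  set c : ℝ := (Real.sqrt n)⁻¹ with hc
  have hc0 : 0 ≤ c := by positivity
  obtain ⟨hC, -⟩ := hK h hhc hb
  set H : E → ℝ := φ ⋆[lsmul ℝ ℝ, lam] h with hH
  have hHc : Continuous H := hC.continuous
  have hclose : ∀ x, |H x - h x| ≤ t := fun x =>
    φb.dist_normed_convolution_le hhc.aestronglyMeasurable fun y hy =>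
      (hh.dist_le_mul y x).trans (by
        rw [NNReal.coe_one, one_mul]
        exact (Metric.mem_ball.1 hy).le)
  have hHb : ∀ x, |H x| ≤ t + 1 := fun x => by
    have h1 := abs_le.1 (hclose x)
    have h2 := abs_le.1 (hb x)
    exact abs_le.2 ⟨by linarith [h1.1, h2.1], by linarith [h1.2, h2.2]⟩
  have key := abs_integral_convPow_sub_le hφ hφi hK0 hK ν γ h3 h3'
    (fun L => (hL L).trans (integral_strongDual_stdGaussian L).symm) hB hc0 n h hhc hb 0
  simp only [zero_add] at key
  have hsm : ∀ ρ : Measure E, ∀ [IsProbabilityMeasure ρ],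
      |∫ s, h (c • s) ∂ρ - ∫ s, H (c • s) ∂ρ| ≤ t := fun ρ _ => by
    rw [← integral_sub (Integrable.of_bound (by fun_prop) 1 (ae_of_all _ fun s => hb _))
      (Integrable.of_bound (by fun_prop) (t + 1) (ae_of_all _ fun s => hHb _))]
    exact abs_integral_le_of_abs_le ρ fun s => by rw [abs_sub_comm]; exact hclose _
  have e1 : ∫ y, h (c • ∑ i, y i) ∂(Measure.pi fun _ : Fin n => ν)
      = ∫ s, h (c • s) ∂(convPow ν n) := by
    have := map_sum_eq_convPow (P := Measure.pi fun _ : Fin n => ν)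
      (Y := fun i y => y i) (fun i => measurable_pi_apply i)
      (iIndepFun_pi (X := fun _ => id) (fun _ => aemeasurable_id))
      (fun i => (measurePreserving_eval (fun _ : Fin n => ν) i).map_eq) Finset.univ
    rw [Finset.card_univ, Fintype.card_fin] at this
    rw [← this, integral_map (by fun_prop) (by fun_prop)]
    simp
  -- Stability of the Gaussian makes both terms integrals over `n`-fold convolution powers.
  have e2 : ∫ z, h z ∂γ = ∫ s, h (c • s) ∂(convPow γ n) := by
    conv_lhs => rw [hγ, ← map_smul_convPow_stdGaussian hn]
    rw [integral_map (by fun_prop) (by fun_prop)]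
  have hs1 := hsm (convPow ν n)
  have hs2 := hsm (convPow γ n)
  have hnc : (n : ℝ) * (K * c ^ 3 * (m + m')) ≤ (K + m') * ((m + (K + m')) / Real.sqrt n) := by
    have hn2 : (n : ℝ) * c ^ 2 = 1 := by
      rw [hc, inv_pow, Real.sq_sqrt (Nat.cast_nonneg n)]
      exact mul_inv_cancel₀ (Nat.cast_ne_zero.2 hn)
    calc (n : ℝ) * (K * c ^ 3 * (m + m')) = (n * c ^ 2) * (K * ((m + m') * c)) := by ring
      _ = K * ((m + m') * c) := by rw [hn2, one_mul]
      _ ≤ (K + m') * ((m + (K + m')) * c) := by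
        gcongr <;> linarith
      _ = _ := by rw [hc, div_eq_mul_inv]
  rw [e1, e2]
  rw [abs_le] at *
  constructor <;> linarith [hs1.1, hs1.2, hs2.1, hs2.2, key.1, key.2]

end GaussianApproximation

/-! ### Consequences of the bounded Lipschitz norm, and block vectors. -/

section BoundedLipschitz

theorem abs_le_one_of_blNorm_le_one {n : ℕ} {f : EuclideanSpace ℝ (Fin n) → ℝ}
    (hf : blNorm f ≤ 1) (x : EuclideanSpace ℝ (Fin n)) : |f x| ≤ 1 := by
  have h1 : ‖f x‖ₑ ≤ 1 :=
    (le_iSup (fun x => ‖f x‖ₑ) x).trans ((self_le_add_left _ _).trans hf)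
  rw [← ofReal_norm, ← ENNReal.ofReal_one,
    ENNReal.ofReal_le_ofReal_iff zero_le_one] at h1
  exact h1

theorem lipschitzWith_one_of_blNorm_le_one {n : ℕ} {f : EuclideanSpace ℝ (Fin n) → ℝ}
    (hf : blNorm f ≤ 1) : LipschitzWith 1 f := by
  intro x y
  rcases eq_or_ne x y with rfl | hxy
  · simp
  have h1 : edist (f x) (f y) / edist x y ≤ 1 :=
    ((le_iSup₂_of_le x y (le_iSup (fun _ : x ≠ y => edist (f x) (f y) / edist x y) hxy)).trans
      (self_le_add_right _ _)).trans hf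
  rw [ENNReal.div_le_iff (edist_pos.2 hxy).ne' (edist_ne_top x y)] at h1
  simpa using h1

theorem dist_concatVec_right {d k : ℕ} (a : EuclideanSpace ℝ (Fin d))
    (w w' : EuclideanSpace ℝ (Fin k)) : dist (concatVec a w) (concatVec a w') = dist w w' := by
  simp [EuclideanSpace.dist_eq, concatVec, Fin.sum_univ_add]

theorem continuous_concatVec {d k : ℕ} :
    Continuous fun p : EuclideanSpace ℝ (Fin d) × EuclideanSpace ℝ (Fin k) =>
      concatVec p.1 p.2 := by
  refine (PiLp.continuous_toLp 2 _).comp (continuous_pi fun i => ?_)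
  refine Fin.addCases (fun i => ?_) (fun i => ?_) i
  · simp only [Fin.append_left]; fun_prop
  · simp only [Fin.append_right]; fun_prop

end BoundedLipschitz

/-! ### Regular conditional distributions and conditional independence. -/

section ConditionalDistribution

variable {Ω β E : Type*} {mΩ : MeasurableSpace Ω} {mβ : MeasurableSpace β} {μ : Measure Ω}
  [IsProbabilityMeasure μ]

theorem exists_countable_piSystem (E : Type*) [mE : MeasurableSpace E]
    [MeasurableSpace.CountablyGenerated E] :
    ∃ C : Set (Set E), C.Countable ∧ IsPiSystem C ∧ Set.univ ∈ C ∧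
      MeasurableSpace.generateFrom C = mE := by
  refine ⟨generateSetAlgebra (MeasurableSpace.countableGeneratingSet E),
    countable_generateSetAlgebra MeasurableSpace.countable_countableGeneratingSet,
    fun s hs t ht _ => isSetAlgebra_generateSetAlgebra.inter_mem hs ht,
    isSetAlgebra_generateSetAlgebra.univ_mem, ?_⟩
  rw [generateFrom_generateSetAlgebra_eq, MeasurableSpace.generateFrom_countableGeneratingSet]

/-- Each product identity for conditional probabilities holds off a null set depending on the
rectangle. Restricting to sides in a countable generating π-system leaves a single null set, and
such rectangles determine the product measure. -/
theorem ae_condDistrib_eq_pi [MeasurableSpace E] [StandardBorelSpace E] [Nonempty E] {N : ℕ}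
    {X : Ω → β} (hX : Measurable X) {W : Fin N → Ω → E} (hW : ∀ u, Measurable (W u))
    (h : CondIID μ (mβ.comap X) W) (u₀ : Fin N) :
    ∀ᵐ ω ∂μ, condDistrib (fun ω u => W u ω) X μ (X ω)
      = Measure.pi fun _ : Fin N =>
        (condDistrib (fun ω u => W u ω) X μ (X ω)).map fun y => y u₀ := by
  set κ := condDistrib (fun ω u => W u ω) X μ
  have hWm : Measurable fun ω u => W u ω := measurable_pi_lambda _ hW
  obtain ⟨C, hCc, hCpi, hCu, hCg⟩ := exists_countable_piSystem E
  have hCm : ∀ s ∈ C, MeasurableSet s := fun s hs =>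
    hCg ▸ MeasurableSpace.measurableSet_generateFrom hs
  have hκ : ∀ s : Set (Fin N → E), MeasurableSet s →
      (fun ω => (κ (X ω)).real s) =ᵐ[μ] μ⟦(fun ω u => W u ω) ⁻¹' s | mβ.comap X⟧ :=
    fun s hs => condDistrib_ae_eq_condExp hX hWm hs
  have hcount : Countable (Fin N → C) := by
    have := hCc.to_subtype
    infer_instance
  have hrect : ∀ᵐ ω ∂μ, ∀ B : Fin N → C, (κ (X ω)).real (Set.univ.pi fun u => (B u : Set E))
      = ∏ u, (κ (X ω)).real ((fun y => y u₀) ⁻¹' (B u : Set E)) := by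
    rw [ae_all_iff]
    intro B
    have hB : ∀ u, MeasurableSet (B u : Set E) := fun u => hCm _ (B u).2
    have h1 := hκ _ (MeasurableSet.univ_pi hB)
    have h2 : ∀ᵐ ω ∂μ, ∀ u, (κ (X ω)).real ((fun y => y u₀) ⁻¹' (B u : Set E))
        = (μ⟦W u₀ ⁻¹' (B u : Set E) | mβ.comap X⟧) ω :=
      ae_all_iff.2 fun u => hκ _ (measurable_pi_apply u₀ (hB u))
    have h3 : ∀ᵐ ω ∂μ, ∀ u, (μ⟦W u ⁻¹' (B u : Set E) | mβ.comap X⟧) ω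
        = (μ⟦W u₀ ⁻¹' (B u : Set E) | mβ.comap X⟧) ω :=
      ae_all_iff.2 fun u => h.ident u u₀ _ (hB u)
    have h4 := h.indep Finset.univ (fun u => (B u : Set E)) fun u _ => hB u
    have e : (fun ω u => W u ω) ⁻¹' (Set.univ.pi fun u => (B u : Set E))
        = ⋂ u ∈ Finset.univ, W u ⁻¹' (B u : Set E) := by
      ext ω; simp
    rw [e] at h1
    filter_upwards [h1, h2, h3, h4] with ω h1 h2 h3 h4
    rw [h1, h4, Finset.prod_apply]
    exact Finset.prod_congr rfl fun u _ => (h3 u).trans (h2 u).symm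
  filter_upwards [hrect] with ω hω
  have hev : Measurable fun y : Fin N → E => y u₀ := measurable_pi_apply u₀
  have : IsProbabilityMeasure ((κ (X ω)).map fun y => y u₀) :=
    Measure.isProbabilityMeasure_map hev.aemeasurable
  refine (Measure.pi_eq_generateFrom (fun _ => hCg) (fun _ => hCpi)
    (fun _ => ⟨fun _ => Set.univ, fun _ => hCu, fun _ => measure_lt_top _ _, Set.iUnion_const _⟩)
    fun s hs => ?_).symm
  have := hω fun u => ⟨s u, hs u⟩
  simp only [measureReal_def] at this
  rw [← ENNReal.toReal_prod,
    ENNReal.toReal_eq_toReal_iff' (measure_ne_top _ _)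
      (ENNReal.prod_ne_top fun _ _ => measure_ne_top _ _)] at this
  rw [this]
  exact Finset.prod_congr rfl fun u _ => (Measure.map_apply hev (hCm _ (hs u))).symm

theorem condLExp_ae_eq_lintegral_condDistrib [MeasurableSpace E] [StandardBorelSpace E]
    [Nonempty E] {X : Ω → β} (hX : Measurable X) {Y : Ω → E} (hY : Measurable Y) {f : E → ℝ≥0∞}
    (hf : Measurable f) :
    μ⁻[fun ω => f (Y ω) | mβ.comap X] =ᵐ[μ] fun ω => ∫⁻ y, f y ∂(condDistrib Y X μ (X ω)) := by
  have hm : Measurable fun b => ∫⁻ y, f y ∂(condDistrib Y X μ b) := hf.lintegral_kernel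
  refine (ae_eq_condLExp (hm := hX.comap_le) μ _
    (hm.comp (Measurable.of_comap_le le_rfl)) ?_).symm
  rintro s ⟨t, ht, rfl⟩
  rw [Function.comp_def, ← setLIntegral_map ht hm hX]
  have := Measure.setLIntegral_compProd (μ := μ.map X) (κ := condDistrib Y X μ)
    (f := fun p : β × E => f p.2) (by fun_prop) ht MeasurableSet.univ
  simp only [Measure.restrict_univ] at this
  rw [← this, compProd_map_condDistrib hY.aemeasurable,
    setLIntegral_map (ht.prod MeasurableSet.univ) (by fun_prop) (hX.prodMk hY)]
  congr 2
  ext; simp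

/-- By independence the conditional distribution of `Z` given `X` is the constant kernel `γ`. -/
theorem condExp_ae_eq_integral_of_indep [MeasurableSpace E] [StandardBorelSpace E] [Nonempty E]
    {X : Ω → β} (hX : Measurable X) {Z : Ω → E} (hZ : Measurable Z) {γ : Measure E}
    (hlaw : HasLaw Z γ μ) (hind : Indep (mβ.comap X) (MeasurableSpace.comap Z inferInstance) μ)
    {G : β × E → ℝ} (hG : StronglyMeasurable G) {M : ℝ} (hM : ∀ p, |G p| ≤ M) :
    μ[fun ω => G (X ω, Z ω) | mβ.comap X] =ᵐ[μ] fun ω => ∫ z, G (X ω, z) ∂γ := by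
  have : IsProbabilityMeasure γ :=
    hlaw.map_eq ▸ Measure.isProbabilityMeasure_map hZ.aemeasurable
  have h1 := condExp_prod_ae_eq_integral_condDistrib (μ := μ) hX hZ.aemeasurable hG
    (Integrable.of_bound (hG.comp_measurable (hX.prodMk hZ)).aestronglyMeasurable M
      (ae_of_all _ fun ω => hM _))
  have h2 : condDistrib Z X μ =ᵐ[μ.map X] Kernel.const β γ := by
    refine condDistrib_ae_eq_of_measure_eq_compProd_of_measurable hX hZ ?_
    rw [Measure.compProd_const, ← hlaw.map_eq]
    exact (indepFun_iff_map_prod_eq_prod_map_map hX.aemeasurable hZ.aemeasurable).1 hind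
  filter_upwards [h1, ae_of_ae_map hX.aemeasurable h2] with ω h1 h2
  rw [h1, h2, Kernel.const_apply]

end ConditionalDistribution

/-! ### Second moments in coordinates. -/

section Moments

variable {k : ℕ}

/-- Reduces the matching of all quadratic forms to the matching of the second-moment matrix. -/
theorem integral_bilin_self (ν : Measure (EuclideanSpace ℝ (Fin k)))
    [IsProbabilityMeasure ν] (h2 : MemLp id 2 ν)
    (B : EuclideanSpace ℝ (Fin k) →L[ℝ] EuclideanSpace ℝ (Fin k) →L[ℝ] ℝ) :
    ∫ y, B y y ∂ν = ∑ i, ∑ j, (∫ y, y i * y j ∂ν)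
      * B (EuclideanSpace.single i 1) (EuclideanSpace.single j 1) := by
  have hi : ∀ i, MemLp (fun y : EuclideanSpace ℝ (Fin k) => y i) 2 ν := fun i =>
    h2.norm.mono (by fun_prop) (ae_of_all _ fun y => by
      simpa using PiLp.norm_apply_le y i)
  have hij : ∀ i j, Integrable (fun y : EuclideanSpace ℝ (Fin k) => y i * y j) ν := fun i j =>
    (hi i).integrable_mul (hi j)
  have hexp : ∀ y : EuclideanSpace ℝ (Fin k), B y y = ∑ i, ∑ j, (y i * y j)
      * B (EuclideanSpace.single i 1) (EuclideanSpace.single j 1) := by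
    intro y
    have hy : y = ∑ i, y i • EuclideanSpace.single i (1 : ℝ) := by
      simpa using ((EuclideanSpace.basisFun (Fin k) ℝ).sum_repr y).symm
    conv_lhs => rw [hy]
    simp only [map_sum, map_smul, _root_.sum_apply, _root_.smul_apply,
      smul_eq_mul, Finset.mul_sum, mul_assoc]
    rw [Finset.sum_comm]
    refine Finset.sum_congr rfl fun i _ => Finset.sum_congr rfl fun j _ => ?_
    ring
  simp_rw [hexp]
  rw [integral_finsetSum _ fun i _ => integrable_finsetSum _ fun j _ => (hij i j).mul_const _]
  refine Finset.sum_congr rfl fun i _ => ?_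
  rw [integral_finsetSum _ fun j _ => (hij i j).mul_const _]
  exact Finset.sum_congr rfl fun j _ => integral_mul_const _ _

theorem integral_mul_stdGaussian (i j : Fin k) :
    ∫ y, y i * y j ∂(stdGaussian (EuclideanSpace ℝ (Fin k)))
      = (1 : Matrix (Fin k) (Fin k) ℝ) i j := by
  have h := covarianceBilin_apply
    (IsGaussian.memLp_two_id (μ := stdGaussian (EuclideanSpace ℝ (Fin k))))
    (EuclideanSpace.single i (1 : ℝ)) (EuclideanSpace.single j 1)
  have h0 : ∫ x, id x ∂(stdGaussian (EuclideanSpace ℝ (Fin k))) = 0 := integral_id_stdGaussian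
  rw [covarianceBilin_stdGaussian, h0] at h
  simpa [Matrix.one_apply, EuclideanSpace.inner_single_left, innerSL_apply_apply ℝ, eq_comm]
    using h.symm

end Moments

/-! ### Transfer of the CLT bound to conditional laws. -/

section ConditionalCLT

variable {Ω β : Type*} {mΩ : MeasurableSpace Ω} {mβ : MeasurableSpace β} {μ : Measure Ω}
  [IsProbabilityMeasure μ] {k d : ℕ}

/-- `ν` is the `u₀` marginal of the conditional distribution at `ω`; the conditional moment
assumptions become its ordinary moments. -/
theorem ae_exists_conditional_law {X : Ω → β} (hX : Measurable X) {N : ℕ}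
    {W : Fin N → Ω → EuclideanSpace ℝ (Fin k)} (hW : ∀ u, Measurable (W u))
    (hiid : CondIID μ (mβ.comap X) W) (u₀ : Fin N) (hL2 : MemLp (W u₀) 2 μ)
    (hmean : μ[W u₀ | mβ.comap X] =ᵐ[μ] 0)
    (hcov : ∀ i j : Fin k, μ[fun ω => W u₀ ω i * W u₀ ω j | mβ.comap X] =ᵐ[μ]
      fun _ => (1 : Matrix (Fin k) (Fin k) ℝ) i j)
    {f : EuclideanSpace ℝ (Fin (d + k)) → ℝ} (hfc : Continuous f) {M : ℝ} (hM : ∀ x, |f x| ≤ M)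
    {A : β → EuclideanSpace ℝ (Fin d)} (hA : Measurable A) :
    ∀ᵐ ω ∂μ, condMoment μ (mβ.comap X) 3 (W u₀) ω ≠ ∞ →
      ∃ ν : Measure (EuclideanSpace ℝ (Fin k)), IsProbabilityMeasure ν ∧
        Integrable (fun y => ‖y‖ ^ 3) ν ∧
        ∫ y, ‖y‖ ^ 3 ∂ν = (condMoment μ (mβ.comap X) 3 (W u₀) ω).toReal ∧
        (∀ L : EuclideanSpace ℝ (Fin k) →L[ℝ] ℝ, ∫ y, L y ∂ν = 0) ∧
        (∀ B : EuclideanSpace ℝ (Fin k) →L[ℝ] EuclideanSpace ℝ (Fin k) →L[ℝ] ℝ,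
          ∫ y, B y y ∂ν = ∫ y, B y y ∂(stdGaussian (EuclideanSpace ℝ (Fin k)))) ∧
        (μ[fun ω' => f (concatVec (A (X ω')) (normalizedSum W ω')) | mβ.comap X]) ω
          = ∫ y, f (concatVec (A (X ω)) ((Real.sqrt N)⁻¹ • ∑ u, y u))
            ∂(Measure.pi fun _ : Fin N => ν) := by
  have hWm : Measurable fun ω u => W u ω := measurable_pi_lambda _ hW
  have hpi := ae_condDistrib_eq_pi hX hW hiid u₀
  have hev : Measurable fun y : Fin N → EuclideanSpace ℝ (Fin k) => y u₀ := measurable_pi_apply u₀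
  set κ := condDistrib (fun ω u => W u ω) X μ
  have hmom : condMoment μ (mβ.comap X) 3 (W u₀) =ᵐ[μ] fun ω => ∫⁻ y, ‖y u₀‖ₑ ^ 3 ∂(κ (X ω)) :=
    condLExp_ae_eq_lintegral_condDistrib hX hWm (f := fun y => ‖y u₀‖ₑ ^ 3) (by fun_prop)
  have hmean' : μ[W u₀ | mβ.comap X] =ᵐ[μ] fun ω => ∫ y, y u₀ ∂(κ (X ω)) :=
    condExp_ae_eq_integral_condDistrib hX hWm.aemeasurable (f := fun y => y u₀)
      hev.stronglyMeasurable (hL2.integrable (by norm_num))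
  have hi : ∀ i, MemLp (fun ω => W u₀ ω i) 2 μ := fun i =>
    hL2.norm.mono (by have := hW u₀; fun_prop) (ae_of_all _ fun ω => by
      simpa using PiLp.norm_apply_le (W u₀ ω) i)
  have hcov' : ∀ᵐ ω ∂μ, ∀ i j, ∫ y, y u₀ i * y u₀ j ∂(κ (X ω))
      = (1 : Matrix (Fin k) (Fin k) ℝ) i j := by
    refine ae_all_iff.2 fun i => ae_all_iff.2 fun j => ?_
    have : μ[fun ω => W u₀ ω i * W u₀ ω j | mβ.comap X] =ᵐ[μ]
        fun ω => ∫ y, y u₀ i * y u₀ j ∂(κ (X ω)) :=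
      condExp_ae_eq_integral_condDistrib hX hWm.aemeasurable (f := fun y => y u₀ i * y u₀ j)
        (by apply Measurable.stronglyMeasurable; fun_prop) ((hi i).integrable_mul (hi j))
    exact this.symm.trans (hcov i j)
  have hGm : StronglyMeasurable fun p : β × (Fin N → EuclideanSpace ℝ (Fin k)) =>
      f (concatVec (A p.1) ((Real.sqrt N)⁻¹ • ∑ u, p.2 u)) :=
    ((hfc.comp continuous_concatVec).measurable.comp
      ((hA.comp measurable_fst).prodMk (by fun_prop))).stronglyMeasurable
  have hG : μ[fun ω' => f (concatVec (A (X ω')) (normalizedSum W ω')) | mβ.comap X] =ᵐ[μ]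
      fun ω => ∫ y, f (concatVec (A (X ω)) ((Real.sqrt N)⁻¹ • ∑ u, y u)) ∂(κ (X ω)) :=
    condExp_prod_ae_eq_integral_condDistrib hX hWm.aemeasurable hGm
      (Integrable.of_bound (hGm.comp_measurable (hX.prodMk hWm)).aestronglyMeasurable M
        (ae_of_all _ fun ω => hM _))
  filter_upwards [hpi, hmom, hmean'.symm.trans hmean, hcov', hG] with ω hpi hmom hmean hcov hG hfin
  set ν := (κ (X ω)).map fun y => y u₀ with hν
  have hνp : IsProbabilityMeasure ν := Measure.isProbabilityMeasure_map hev.aemeasurable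
  have hmomν : ∫⁻ y, ‖y‖ₑ ^ 3 ∂ν = condMoment μ (mβ.comap X) 3 (W u₀) ω := by
    rw [hν, lintegral_map (by fun_prop) hev, hmom]
  have henorm : ∀ y : EuclideanSpace ℝ (Fin k), ‖‖y‖ ^ 3‖ₑ = ‖y‖ₑ ^ 3 := fun y => by
    rw [enorm_pow, enorm_norm]
  have h3 : Integrable (fun y => ‖y‖ ^ 3) ν := by
    refine ⟨by fun_prop, ?_⟩
    rw [hasFiniteIntegral_iff_enorm]
    simp_rw [henorm]
    rw [hmomν]
    exact hfin.lt_top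
  have hm3 : MemLp id 3 ν := by
    rw [← integrable_norm_rpow_iff aestronglyMeasurable_id (by norm_num) (by norm_num)]
    simpa using h3
  have h2 : MemLp id 2 ν := hm3.mono_exponent (by norm_num)
  have h1 : Integrable (fun y => y) ν := hm3.integrable (by norm_num)
  refine ⟨ν, hνp, h3, ?_, fun L => ?_, fun B => ?_, ?_⟩
  · rw [integral_eq_lintegral_of_nonneg_ae (ae_of_all _ fun y => by positivity) (by fun_prop),
      ← hmomν]
    congr 2 with y
    rw [← henorm, Real.enorm_of_nonneg (by positivity)]
  · rw [L.integral_comp_comm h1, hν, integral_map hev.aemeasurable (by fun_prop), hmean]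
    exact map_zero L
  · rw [integral_bilin_self ν h2, integral_bilin_self _ IsGaussian.memLp_two_id]
    refine Finset.sum_congr rfl fun i _ => Finset.sum_congr rfl fun j _ => ?_
    rw [integral_mul_stdGaussian, hν, integral_map hev.aemeasurable (by fun_prop), hcov]
  · rw [hG, hpi]

/-- `C` is chosen before `m`, `N`, `W` and `A`, so one constant serves the whole sequence. -/
theorem exists_ae_abs_condExp_sub_integral_stdGaussian_le (μ : Measure Ω) [IsProbabilityMeasure μ]
    {f : EuclideanSpace ℝ (Fin (d + k)) → ℝ} (hf : blNorm f ≤ 1) {t : ℝ} (ht : 0 < t) :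
    ∃ C : ℝ, 0 ≤ C ∧ ∀ (m : MeasurableSpace Ω), m ≤ mΩ → ∀ (N : ℕ)
      (W : Fin N → Ω → EuclideanSpace ℝ (Fin k)), (∀ u, Measurable[mΩ] (W u)) →
      CondIID μ m W →
      ∀ u₀ : Fin N, MemLp (W u₀) 2 μ → μ[W u₀ | m] =ᵐ[μ] 0 →
      (∀ i j : Fin k, μ[fun ω => W u₀ ω i * W u₀ ω j | m] =ᵐ[μ]
        fun _ => (1 : Matrix (Fin k) (Fin k) ℝ) i j) →
      ∀ A : Ω → EuclideanSpace ℝ (Fin d), Measurable[m] A →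
      ∀ᵐ ω ∂μ, condMoment μ m 3 (W u₀) ω ≠ ∞ →
        |(μ[fun ω' => f (concatVec (A ω') (normalizedSum W ω')) | m]) ω
          - ∫ z, f (concatVec (A ω) z) ∂(stdGaussian (EuclideanSpace ℝ (Fin k)))|
        ≤ 2 * t + C * (((condMoment μ m 3 (W u₀) ω).toReal + C) / Real.sqrt N) := by
  obtain ⟨C, hC0, hC⟩ := exists_abs_integral_normalized_sum_sub_stdGaussian_le
    (E := EuclideanSpace ℝ (Fin k)) ht
  refine ⟨C, hC0, fun m hm N W hW hiid u₀ hL2 hmean hcov A hA => ?_⟩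
  -- Conditioning on `m` is conditioning on the identity map from `Ω` to `Ω` equipped with `m`.
  have hid : m.comap id = m := MeasurableSpace.comap_id
  have hfl := lipschitzWith_one_of_blNorm_le_one hf
  have hfb := abs_le_one_of_blNorm_le_one hf
  have key := ae_exists_conditional_law (mβ := m) (X := id) (μ := μ) (measurable_id'' hm) hW
    (by rwa [hid]) u₀ hL2 (by rwa [hid]) (by rwa [hid]) hfl.continuous hfb hA
  simp only [hid, id_eq] at key
  filter_upwards [key] with ω hω hfin
  obtain ⟨ν, hνp, h3, h3e, hL, hB, hE⟩ := hω hfin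
  rw [hE, ← h3e]
  exact hC N (Fin.pos u₀).ne' ν h3 hL hB (fun z => f (concatVec (A ω) z))
    (LipschitzWith.of_dist_le_mul fun z z' => by
      simpa [dist_concatVec_right] using
        hfl.dist_le_mul (concatVec (A ω) z) (concatVec (A ω) z')) fun z => hfb _

end ConditionalCLT

/-! ### Convergence in probability. -/

theorem mainTheorem4 {Ω : Type*} {m0 : MeasurableSpace Ω} (μ : Measure Ω) [IsProbabilityMeasure μ]
    (k d : ℕ)
    (F : ℕ → MeasurableSpace Ω) (hF : ∀ N, F N ≤ m0)
    (W : (N : ℕ) → Fin N → Ω → EuclideanSpace ℝ (Fin k))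
    (hW : ∀ N u, Measurable (W N u))
    (hiid : ∀ N, CondIID μ (F N) (W N))
    -- square integrability is forced by the identity conditional covariance; it is stated because
    -- Mathlib's conditional expectation is zero for functions that are not integrable
    (hL2 : ∀ N u, MemLp (W N u) 2 μ)
    (hmean : ∀ N u, μ[W N u | F N] =ᵐ[μ] 0)
    (hcov : ∀ N u (i j : Fin k),
      μ[fun ω => W N u ω i * W N u ω j | F N] =ᵐ[μ] fun _ => (1 : Matrix (Fin k) (Fin k) ℝ) i j)
    -- given `F N`, the moments of `W N u` do not depend on `u`, so the maximum over `u` is only a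
    -- way of writing their common value
    (hmoment4 : IsLittleOpOne μ
      (fun N ω => (⨆ u : Fin N, condMoment μ (F N) 4 (W N u) ω) / (N : ℝ≥0∞)))
    (hmoment3 : IsLittleOpOne μ
      (fun N ω => (⨆ u : Fin N, condMoment μ (F N) 3 (W N u) ω) / ENNReal.ofReal (Real.sqrt N)))
    (X : ℕ → Ω → EuclideanSpace ℝ (Fin k)) (hX : ∀ N, Measurable[F N] (X N))
    (g : ℕ → EuclideanSpace ℝ (Fin k) → EuclideanSpace ℝ (Fin d)) (hg : ∀ N, Measurable (g N))
    (f : EuclideanSpace ℝ (Fin (d + k)) → ℝ) (hf : blNorm f ≤ 1) :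
    -- the Gaussian term written as the integral of `f (g_N (X_N), ·)` against `N(0, I_k)`
    TendstoInMeasure μ
      (fun N ω =>
        (μ[fun ω' => f (concatVec (g N (X N ω')) (normalizedSum (W N) ω')) | F N]) ω
          - ∫ z, f (concatVec (g N (X N ω)) z) ∂(stdGaussian (EuclideanSpace ℝ (Fin k))))
      atTop (fun _ => 0) ∧
    -- the Gaussian term written with a Gaussian vector on `Ω` that is independent of each `F N`
    ∀ Z : Ω → EuclideanSpace ℝ (Fin k), Measurable Z →
      HasLaw Z (stdGaussian (EuclideanSpace ℝ (Fin k))) μ →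
      (∀ N, Indep (F N) (MeasurableSpace.comap Z inferInstance) μ) →
      TendstoInMeasure μ
        (fun N ω =>
          (μ[fun ω' => f (concatVec (g N (X N ω')) (normalizedSum (W N) ω')) | F N]) ω
            - (μ[fun ω' => f (concatVec (g N (X N ω')) (Z ω')) | F N]) ω)
        atTop (fun _ => 0) := by
  have hfl := lipschitzWith_one_of_blNorm_le_one hf
  have hfb := abs_le_one_of_blNorm_le_one hf
  have hA : ∀ N, Measurable[F N] fun ω => g N (X N ω) := fun N => (hg N).comp (hX N)
  have hmain : TendstoInMeasure μ
      (fun N ω =>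
        (μ[fun ω' => f (concatVec (g N (X N ω')) (normalizedSum (W N) ω')) | F N]) ω
          - ∫ z, f (concatVec (g N (X N ω)) z) ∂(stdGaussian (EuclideanSpace ℝ (Fin k))))
      atTop (fun _ => 0) := by
    rw [tendstoInMeasure_iff_norm]
    intro ε hε
    -- Error budget: `2 t = ε / 4`, `C η ≤ ε / 4`, and `C * C / √N < ε / 4` eventually, which sum to
    -- less than `ε`. The `C + 1` in `η` covers `C = 0`.
    obtain ⟨C, hC0, hC⟩ := exists_ae_abs_condExp_sub_integral_stdGaussian_le (k := k) (d := d) μ hf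
      (t := ε / 8) (by positivity)
    set η : ℝ := ε / (4 * (C + 1)) with hη
    have hη0 : 0 < η := by positivity
    have hsq : Tendsto (fun N : ℕ => C * C / Real.sqrt N) atTop (𝓝 0) :=
      Tendsto.div_atTop tendsto_const_nhds (Real.tendsto_sqrt_atTop.comp tendsto_natCast_atTop_atTop)
    refine tendsto_of_tendsto_of_tendsto_of_le_of_le' tendsto_const_nhds
      (hmoment3 (ENNReal.ofReal η) (ENNReal.ofReal_pos.2 hη0))
      (Eventually.of_forall fun _ => bot_le) ?_
    filter_upwards [hsq.eventually_lt_const (by positivity : 0 < ε / 4), eventually_gt_atTop 0]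
      with N hN hN0
    let u₀ : Fin N := ⟨0, hN0⟩
    have hs : 0 < Real.sqrt N := Real.sqrt_pos.2 (Nat.cast_pos.2 hN0)
    -- Up to a null set, a deviation of at least `ε` forces the normalized third moment to be at
    -- least `η`; below `η` that moment is finite and the bound applies.
    refine measure_mono_ae ?_
    filter_upwards [hC (F N) (hF N) N (W N) (hW N) (hiid N) u₀ (hL2 N u₀) (hmean N u₀)
      (hcov N u₀) _ (hA N)] with ω hω hle
    by_contra hlt
    have hlt' : (⨆ u : Fin N, condMoment μ (F N) 3 (W N u) ω) / ENNReal.ofReal (Real.sqrt N)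
        < ENNReal.ofReal η := not_le.1 fun h => hlt h
    rw [ENNReal.div_lt_iff (Or.inl (ENNReal.ofReal_pos.2 hs).ne') (Or.inl ENNReal.ofReal_ne_top),
      ← ENNReal.ofReal_mul hη0.le] at hlt'
    have hM := (le_iSup (fun u : Fin N => condMoment μ (F N) 3 (W N u) ω) u₀).trans_lt hlt'
    have hfin : condMoment μ (F N) 3 (W N u₀) ω ≠ ∞ := (hM.trans ENNReal.ofReal_lt_top).ne
    have hMr : (condMoment μ (F N) 3 (W N u₀) ω).toReal / Real.sqrt N < η := by
      rw [div_lt_iff₀ hs]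
      exact (ENNReal.lt_ofReal_iff_toReal_lt hfin).1 hM
    have hb := hω hfin
    have hCη : C * η ≤ ε / 4 := by
      rw [hη, mul_div_assoc', div_le_div_iff₀ (by positivity) (by positivity)]
      nlinarith
    have hsplit : C * (((condMoment μ (F N) 3 (W N u₀) ω).toReal + C) / Real.sqrt N)
        = C * ((condMoment μ (F N) 3 (W N u₀) ω).toReal / Real.sqrt N) + C * C / Real.sqrt N := by
      ring
    have hCM := mul_le_mul_of_nonneg_left hMr.le hC0
    have hle' : ε ≤ |(μ[fun ω' => f (concatVec (g N (X N ω')) (normalizedSum (W N) ω')) | F N]) ω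
          - ∫ z, f (concatVec (g N (X N ω)) z) ∂(stdGaussian (EuclideanSpace ℝ (Fin k)))| := by
      rw [← sub_zero (_ - _), ← Real.norm_eq_abs]
      exact hle
    linarith
  -- The two forms of the Gaussian term agree almost surely for each `N`.
  refine ⟨hmain, fun Z hZ hlaw hind => hmain.congr_left fun N => ?_⟩
  have hid : (F N).comap id = F N := MeasurableSpace.comap_id
  have hGm : StronglyMeasurable[(F N).prod inferInstance] fun p : Ω × EuclideanSpace ℝ (Fin k) =>
      f (concatVec (g N (X N p.1)) p.2) :=
    (((hfl.continuous.comp continuous_concatVec).measurable.comp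
      (((hA N).comp measurable_fst).prodMk measurable_snd))).stronglyMeasurable
  have hZe := condExp_ae_eq_integral_of_indep (mβ := F N) (X := id) (μ := μ)
    (measurable_id'' (hF N)) hZ hlaw (by rw [hid]; exact hind N) hGm fun p => hfb _
  rw [hid] at hZe
  filter_upwards [hZe] with ω hω
  exact congrArg _ hω.symm
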